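/- A map $\mathcal M$ (a 2-cell embedding of a connected graph on a surface) is described by its non-empty set of flags $\mathcal F$ with the permutations $s_0,s_1,s_2$ of $\mathcal F$ that send a flag to its $0$-, $1$- and $2$-adjacent flag: $s_0,s_1,s_2$ and $s_0s_2=s_2s_0$ are fixed-point-free involutions, and $\langle s_0,s_1,s_2\rangle$ is transitive on $\mathcal F$. An automorphism of $\mathcal M$ is a permutation of $\mathcal F$ that commutes with $s_0,s_1,s_2$, and $\mathcal M$ is a $k$-orbit map if its automorphism group $\Gamma(\mathcal M)$ has exactly $k$ orbits on $\mathcal F$. The symmetry type graph $T(\mathcal M)$ is the edge-coloured cubic pregraph whose vertices are these orbits, with an edge of colour $i\in\{0,1,2\}$ between two orbits (a semi-edge if they coincide) when they contain flags that are $i$-adjacent. The map $\mathcal M$ is of type $T$ if $T(\mathcal M)$ is isomorphic to $T$ by a colour-preserving isomorphism. The truncation $\mathrm{Tr}(\mathcal M)$ is the map with set of flags $\mathcal F\times\{0,1,2\}$ and flag adjacencies $$\begin{aligned} (\Phi,0)r_0&=(\Phi s_1,0), & (\Phi,0)r_1&=(\Phi s_2,0), & (\Phi,0)r_2&=(\Phi,2),\\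 (\Phi,1)r_0&=(\Phi s_0,1), & (\Phi,1)r_1&=(\Phi,2), & (\Phi,1)r_2&=(\Phi s_2,1),\\ (\Phi,2)r_0&=(\Phi s_1,2), & (\Phi,2)r_1&=(\Phi,1), & (\Phi,2)r_2&=(\Phi,0). \end{aligned}$$ The following graphs are given by the pairs of vertices joined by an edge of each colour; a vertex that is in no pair of colour $i$ has a semi-edge of colour $i$. On the vertices $0,\dots,5$: * $6_D$: colour $0$: $23,45$; colour $1$: $12$; colour $2$: $01,24,35$. * $6_F$: colour $0$: $23,45$; colour $1$: $12,45$; colour $2$: $01,24,35$. * $6_{M_{opp}}$: colour $0$: $13,45$; colour $1$: $01,25$; colour $2$: $02,14,35$. On the vertices $0,\dots,8$: * $9_A$: colour $0$: $36,58$; colour $1$: $03,12,45,78$; colour $2$: $02,14,35,68$. * $9_B$: colour $0$: $14,36,58$; colour $1$: $12,45,78$; colour $2$: $02,35,68$. * $9_{C_d}$: colour $0$: $14,36,58$; colour $1$: $03,12,45,78$; colour $2$: $02,14,35,68$. **Proposition.** If $\mathcal M$ is a $6$-orbit map whose truncation $\mathrm{Tr}(\mathcal M)$ is a $9$-orbit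 map, then exactly one of the following holds: 1. $\mathcal M$ is of type $6_D$ and $\mathrm{Tr}(\mathcal M)$ is of type $9_A$; 2. $\mathcal M$ is of type $6_F$ and $\mathrm{Tr}(\mathcal M)$ is of type $9_B$; 3. $\mathcal M$ is of type $6_{M_{opp}}$ and $\mathrm{Tr}(\mathcal M)$ is of type $9_{C_d}$. -/

import Mathlib

/-! ### Properly edge-3-coloured cubic pregraphs (parallel edges and semi-edges allowed) -/

/-- A cubic pregraph on `V` whose edges are properly coloured with the colours `0, 1, 2`: at each
vertex there is exactly one edge of each colour. `Adj i u v` says that the edge of colour `i` at `u`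
ends at `v`; `Adj i u u` says that there is a semi-edge of colour `i` at `u`. Parallel edges are
edges of different colours with the same end-points. -/
structure ColouredPregraph (V : Type*) where
  Adj : Fin 3 → V → V → Prop
  symm : ∀ i u v, Adj i u v → Adj i v u
  existsUnique_adj : ∀ i u, ∃! v, Adj i u v

namespace ColouredPregraph

/-- A colour-preserving isomorphism of pregraphs. -/
structure Iso {V W : Type*} (G : ColouredPregraph V) (H : ColouredPregraph W) extends V ≃ W where
  adj_iff : ∀ i u v, G.Adj i u v ↔ H.Adj i (toFun u) (toFun v)

/-- The pregraph in which the edge of colour `i` at `u` joins `u` to `p i u`; it is a semi-edge when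
`p i u = u`. -/
def ofInvolutions {V : Type*} (p : Fin 3 → V → V) (hp : ∀ i, Function.Involutive (p i)) :
    ColouredPregraph V where
  Adj i u v := p i u = v
  symm i u v h := by rw [← h]; exact hp i u
  existsUnique_adj i u := ⟨p i u, rfl, fun _ h => h.symm⟩

/-! The six concrete graphs. In a row `![a₀, a₁, …]` for colour `i`, the vertex `v` is joined to
`a_v` by the edge of colour `i`, and `a_v = v` is a semi-edge. -/

/-- The graph `6_D`. -/
def type6D : ColouredPregraph (Fin 6) :=
  ofInvolutions
    ![![0, 1, 3, 2, 5, 4],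
      ![0, 2, 1, 3, 4, 5],
      ![1, 0, 4, 5, 2, 3]]
    (by unfold Function.Involutive; decide)

/-- The graph `6_F`. -/
def type6F : ColouredPregraph (Fin 6) :=
  ofInvolutions
    ![![0, 1, 3, 2, 5, 4],
      ![0, 2, 1, 3, 5, 4],
      ![1, 0, 4, 5, 2, 3]]
    (by unfold Function.Involutive; decide)

/-- The graph `6_{M_opp}`. -/
def type6Mopp : ColouredPregraph (Fin 6) :=
  ofInvolutions
    ![![0, 3, 2, 1, 5, 4],
      ![1, 0, 5, 3, 4, 2],
      ![2, 4, 0, 5, 1, 3]]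
    (by unfold Function.Involutive; decide)

/-- The graph `9_A`: the truncated graph of the three-vertex type `3^0`, with the three vertices
`(v, 0), (v, 1), (v, 2)` over the vertex `v` numbered `3 v, 3 v + 1, 3 v + 2`. -/
def type9A : ColouredPregraph (Fin 9) :=
  ofInvolutions
    ![![0, 1, 2, 6, 4, 8, 3, 7, 5],
      ![3, 2, 1, 0, 5, 4, 6, 8, 7],
      ![2, 4, 0, 5, 1, 3, 8, 7, 6]]
    (by unfold Function.Involutive; decide)

/-- The graph `9_B`: the truncated graph of the three-vertex type `3^2`, numbered in the same way. -/
def type9B : ColouredPregraph (Fin 9) :=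
  ofInvolutions
    ![![0, 4, 2, 6, 1, 8, 3, 7, 5],
      ![0, 2, 1, 3, 5, 4, 6, 8, 7],
      ![2, 1, 0, 5, 4, 3, 8, 7, 6]]
    (by unfold Function.Involutive; decide)

/-- The graph `9_{C_d}`: the truncated graph of the three-vertex type `3^{02}`, numbered in the same
way. -/
def type9Cd : ColouredPregraph (Fin 9) :=
  ofInvolutions
    ![![0, 4, 2, 6, 1, 8, 3, 7, 5],
      ![3, 2, 1, 0, 5, 4, 6, 8, 7],
      ![2, 4, 0, 5, 1, 3, 8, 7, 6]]
    (by unfold Function.Involutive; decide)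

end ColouredPregraph

/-! ### Maps, given by their flags -/

/-- A map with set of flags `F`, given by its flag graph: `s i Φ` is the flag `i`-adjacent to `Φ`.
The `s i` and `s 0 * s 2 = s 2 * s 0` are fixed-point-free involutions, and the monodromy group
generated by the `s i` is transitive on the flags. -/
structure FlagMap (F : Type*) where
  s : Fin 3 → Equiv.Perm F
  involutive : ∀ i Φ, s i (s i Φ) = Φ
  ne_self : ∀ i Φ, s i Φ ≠ Φ
  comm : ∀ Φ, s 0 (s 2 Φ) = s 2 (s 0 Φ)
  ne_self_zero_two : ∀ Φ, s 0 (s 2 Φ) ≠ Φ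
  nonempty : Nonempty F
  transitive : MulAction.IsPretransitive (Subgroup.closure (Set.range s)) F

namespace FlagMap

variable {F : Type*} (M : FlagMap F)

/-- The automorphism group, acting on flags: the permutations of the flags that preserve
`i`-adjacency for `i = 0, 1, 2`. -/
def autGroup : Subgroup (Equiv.Perm F) where
  carrier := {γ | ∀ i Φ, γ (M.s i Φ) = M.s i (γ Φ)}
  mul_mem' {a b} ha hb i Φ := by
    simp only [Set.mem_ofPred_eq] at ha hb
    simp [Equiv.Perm.mul_apply, ha, hb]
  one_mem' i Φ := rfl
  inv_mem' {a} ha i Φ := by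
    simp only [Set.mem_ofPred_eq] at ha
    rw [Equiv.Perm.inv_eq_iff_eq, ha]
    exact congrArg (M.s i) (a.apply_symm_apply Φ).symm

/-- The set of flag-orbits under the automorphism group. -/
abbrev Orb : Type _ := MulAction.orbitRel.Quotient M.autGroup F

/-- The flag-orbit of a flag. -/
def orb (Φ : F) : M.Orb := Quotient.mk'' Φ

/-- `M` is a `k`-orbit map. -/
def IsOrbitMap (k : ℕ) : Prop := Finite M.Orb ∧ Nat.card M.Orb = k

theorem orb_s_eq {Φ Ψ : F} (i : Fin 3) (h : M.orb Φ = M.orb Ψ) :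
    M.orb (M.s i Φ) = M.orb (M.s i Ψ) := by
  obtain ⟨γ, hγ⟩ := MulAction.orbitRel_apply.1 (Quotient.eq''.1 h)
  refine Quotient.eq''.2 (MulAction.orbitRel_apply.2 ⟨γ, ?_⟩)
  have h1 : γ.1 Ψ = Φ := hγ
  change γ.1 (M.s i Ψ) = M.s i Φ
  rw [γ.2 i Ψ, h1]

/-- The symmetry type graph: its vertices are the flag-orbits, and two of them are joined by an edge
of colour `i` (a semi-edge if they coincide) when they contain `i`-adjacent flags. -/
def symmetryTypeGraph : ColouredPregraph M.Orb where
  Adj i u v := ∃ Φ Ψ : F, M.orb Φ = u ∧ M.orb Ψ = v ∧ M.s i Φ = Ψ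
  symm := by
    rintro i u v ⟨Φ, Ψ, hu, hv, h⟩
    exact ⟨Ψ, Φ, hv, hu, by rw [← h, M.involutive]⟩
  existsUnique_adj := by
    intro i u
    induction u using Quotient.inductionOn' with
    | h Φ =>
      refine ⟨M.orb (M.s i Φ), ⟨Φ, M.s i Φ, rfl, rfl, rfl⟩, ?_⟩
      rintro v ⟨Φ', Ψ', h1, rfl, rfl⟩
      exact M.orb_s_eq i h1

/-- `M` is of type `T`: its symmetry type graph is isomorphic to `T`. -/
def HasType {V : Type*} (T : ColouredPregraph V) : Prop :=
  Nonempty (ColouredPregraph.Iso M.symmetryTypeGraph T)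

/-! ### Truncation -/

/-- The flag adjacencies `r 0`, `r 1`, `r 2` of the truncation; each flag `Φ` of `M` is divided into
the three flags `(Φ, 0)`, `(Φ, 1)`, `(Φ, 2)`. -/
def truncAdj : Fin 3 → F × Fin 3 → F × Fin 3
  | 0, (Φ, 0) => (M.s 1 Φ, 0)
  | 1, (Φ, 0) => (M.s 2 Φ, 0)
  | 2, (Φ, 0) => (Φ, 2)
  | 0, (Φ, 1) => (M.s 0 Φ, 1)
  | 1, (Φ, 1) => (Φ, 2)
  | 2, (Φ, 1) => (M.s 2 Φ, 1)
  | 0, (Φ, 2) => (M.s 1 Φ, 2)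
  | 1, (Φ, 2) => (Φ, 1)
  | 2, (Φ, 2) => (Φ, 0)

theorem truncAdj_involutive (i : Fin 3) : Function.Involutive (M.truncAdj i) := by
  rintro ⟨Φ, j⟩
  fin_cases i <;> fin_cases j <;> simp [truncAdj, M.involutive]

/-- The adjacencies of the truncation as permutations. -/
def truncPerm (i : Fin 3) : Equiv.Perm (F × Fin 3) := (M.truncAdj_involutive i).toPerm

theorem truncPerm_apply (i : Fin 3) (x : F × Fin 3) : M.truncPerm i x = M.truncAdj i x := rfl

theorem truncPerm_transitive :
    MulAction.IsPretransitive (Subgroup.closure (Set.range M.truncPerm)) (F × Fin 3) := by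
  let G := Subgroup.closure (Set.range M.truncPerm)
  let R : F × Fin 3 → F × Fin 3 → Prop := fun x y => ∃ g : G, g • x = y
  have hrefl : ∀ x, R x x := fun x => ⟨1, one_smul _ _⟩
  have hsymm : ∀ {x y}, R x y → R y x := by
    rintro x y ⟨g, rfl⟩; exact ⟨g⁻¹, inv_smul_smul _ _⟩
  have htrans : ∀ {x y z}, R x y → R y z → R x z := by
    rintro x y z ⟨g, rfl⟩ ⟨h, rfl⟩; exact ⟨h * g, mul_smul _ _ _⟩
  have hstep : ∀ i x, R x (M.truncAdj i x) := fun i x =>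
    ⟨⟨M.truncPerm i, Subgroup.subset_closure ⟨i, rfl⟩⟩, rfl⟩
  have h02 : ∀ Φ, R (Φ, 0) (Φ, 2) := fun Φ => hstep 2 (Φ, 0)
  have h21 : ∀ Φ, R (Φ, 2) (Φ, 1) := fun Φ => hstep 1 (Φ, 2)
  have h01 : ∀ Φ, R (Φ, 0) (Φ, 1) := fun Φ => htrans (h02 Φ) (h21 Φ)
  have hs : ∀ i Φ, R (Φ, 0) (M.s i Φ, 0) := by
    intro i Φ
    fin_cases i
    · exact htrans (h01 Φ) (htrans (hstep 0 (Φ, 1)) (hsymm (h01 _)))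
    · exact hstep 0 (Φ, 0)
    · exact hstep 1 (Φ, 0)
  have hmon : ∀ g ∈ Subgroup.closure (Set.range M.s), ∀ Φ, R (Φ, 0) (g Φ, 0) := by
    intro g hg
    induction hg using Subgroup.closure_induction with
    | mem g hg => obtain ⟨i, rfl⟩ := hg; exact hs i
    | one => exact fun Φ => hrefl _
    | mul g h _ _ ihg ihh => exact fun Φ => htrans (ihh Φ) (ihg (h Φ))
    | inv g _ ih =>
      intro Φ
      have := ih (g⁻¹ Φ)
      rw [← Equiv.Perm.mul_apply, mul_inv_cancel, Equiv.Perm.one_apply] at this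
      exact hsymm this
  have hbase : ∀ Φ j, R (Φ, 0) (Φ, j) := by
    intro Φ j
    fin_cases j
    · exact hrefl _
    · exact h01 Φ
    · exact h02 Φ
  constructor
  rintro ⟨Φ, j⟩ ⟨Ψ, k⟩
  obtain ⟨g, hg⟩ := M.transitive.exists_smul_eq Φ Ψ
  have h1 := hmon g.1 g.2 Φ
  have h2 : g.1 Φ = Ψ := hg
  rw [h2] at h1
  exact htrans (hsymm (hbase Φ j)) (htrans h1 (hbase Ψ k))

/-- The truncation of a map. -/
def truncation : FlagMap (F × Fin 3) where
  s := M.truncPerm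
  involutive := M.truncAdj_involutive
  ne_self := by
    rintro i ⟨Φ, j⟩
    rw [truncPerm_apply]
    fin_cases i <;> fin_cases j <;> simp [truncAdj, M.ne_self]
  comm := by
    rintro ⟨Φ, j⟩
    simp only [truncPerm_apply]
    fin_cases j <;> simp [truncAdj, M.comm]
  ne_self_zero_two := by
    rintro ⟨Φ, j⟩
    simp only [truncPerm_apply]
    fin_cases j <;> simp [truncAdj, M.ne_self_zero_two]
  nonempty := M.nonempty.map fun Φ => (Φ, 0)
  transitive := M.truncPerm_transitive

end FlagMap

/-! The flag-orbits of the truncation `Tr` of `M` carry, besides the given adjacencies, the layers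
`{(Φ, j)}` for `j = 0, 1, 2`. The adjacency `r i` moves layers by a fixed permutation
(`layerPerm i`), so an automorphism of `Tr` that preserves the layer of a single flag preserves all
layers and hence comes from an automorphism of `M`. Thus each layer embeds the orbits of `M` into
the orbits of `Tr` (`layerMap_injective`). By connectedness every orbit of `Tr` meets the same number
of layers, and if `Tr` has `9` orbits and `M` has `6` that number is `6 * 3 / 9 = 2`. Each orbit of
`Tr` therefore *misses* exactly one layer (`exists_missedLayer`).

The missed layer is permuted by the adjacencies in the same way as the layers themselves, so it
exhibits the symmetry type graph of `Tr` as the truncation of the graph on the three orbits that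
miss layer `0` (`exists_truncStep_model`). A connected graph of this kind on three vertices whose
involutions of colours `0` and `2` commute is one of `3^0`, `3^2` and `3^{02}`
(`three_vertex_classification`), and their truncations are `9_A`, `9_B` and `9_{C_d}`. Finally
layer `0` identifies the orbits of `M` with the orbits of `Tr` that do not miss layer `0`, with
the adjacencies of `M` being `r₂ r₁ r₀ r₁ r₂`, `r₀` and `r₁`; this gives `6_D`, `6_F` and
`6_{M_opp}` in the three cases. The cases exclude each other since no two of `9_A`, `9_B`, `9_{C_d}`
have the same number of semi-edges in each colour. -/

namespace FlagMap

/-! ### Connectedness and adjacency of flag-orbits -/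

section Orbits

variable {F : Type*} (M : FlagMap F)

theorem flag_induction {P : F → Prop} (hP : ∀ i Φ, P Φ → P (M.s i Φ)) {Φ : F} (hΦ : P Φ) (Ψ : F) :
    P Ψ := by
  have hiff : ∀ g ∈ Subgroup.closure (Set.range M.s), ∀ x, P x ↔ P (g x) := by
    intro g hg
    induction hg using Subgroup.closure_induction with
    | mem g hg =>
      obtain ⟨i, rfl⟩ := hg
      exact fun x => ⟨hP i x, fun h => by simpa [M.involutive] using hP i _ h⟩
    | one => exact fun x => Iff.rfl
    | mul g h _ _ ihg ihh => exact fun x => (ihh x).trans (ihg (h x))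
    | inv g _ ih => exact fun x => by simpa using (ih (g⁻¹ x)).symm
  obtain ⟨g, hg⟩ := M.transitive.exists_smul_eq Φ Ψ
  have h : g.1 Φ = Ψ := hg
  exact h ▸ (hiff g.1 g.2 Φ).1 hΦ

theorem orb_surjective : Function.Surjective M.orb := Quotient.mk''_surjective

theorem orb_eq_iff {Φ Ψ : F} : M.orb Φ = M.orb Ψ ↔ ∃ γ ∈ M.autGroup, γ Ψ = Φ :=
  ⟨fun h => by
    obtain ⟨γ, hγ⟩ := MulAction.orbitRel_apply.1 (Quotient.eq''.1 h)
    exact ⟨γ.1, γ.2, hγ⟩,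
  fun ⟨γ, hγ, h⟩ => Quotient.eq''.2 (MulAction.orbitRel_apply.2 ⟨⟨γ, hγ⟩, h⟩)⟩

/-- The other end of the edge of colour `i` at an orbit in the symmetry type graph. -/
def orbAdj (i : Fin 3) : M.Orb → M.Orb :=
  Quotient.lift (fun Φ => M.orb (M.s i Φ)) fun _ _ h => M.orb_s_eq i (Quotient.sound h)

@[simp] theorem orbAdj_orb (i : Fin 3) (Φ : F) : M.orbAdj i (M.orb Φ) = M.orb (M.s i Φ) := rfl

@[simp] theorem orbAdj_orbAdj (i : Fin 3) (u : M.Orb) : M.orbAdj i (M.orbAdj i u) = u := by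
  obtain ⟨Φ, rfl⟩ := M.orb_surjective u
  simp [M.involutive]

theorem orbAdj_comm (u : M.Orb) : M.orbAdj 0 (M.orbAdj 2 u) = M.orbAdj 2 (M.orbAdj 0 u) := by
  obtain ⟨Φ, rfl⟩ := M.orb_surjective u
  simp [M.comm]

theorem orb_induction {P : M.Orb → Prop} (hP : ∀ i u, P u → P (M.orbAdj i u)) {u : M.Orb}
    (hu : P u) (v : M.Orb) : P v := by
  obtain ⟨Φ, rfl⟩ := M.orb_surjective u
  obtain ⟨Ψ, rfl⟩ := M.orb_surjective v
  exact M.flag_induction (P := fun Φ => P (M.orb Φ)) (fun i Φ h => hP i _ h) hu Ψ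

theorem symmetryTypeGraph_adj_iff {i : Fin 3} {u v : M.Orb} :
    M.symmetryTypeGraph.Adj i u v ↔ M.orbAdj i u = v := by
  constructor
  · rintro ⟨Φ, Ψ, rfl, rfl, rfl⟩
    rfl
  · rintro rfl
    obtain ⟨Φ, rfl⟩ := M.orb_surjective u
    exact ⟨Φ, M.s i Φ, rfl, rfl, rfl⟩

/-- It suffices that the bijection preserves adjacency in one direction, because every vertex has
exactly one edge of each colour. -/
theorem hasType_of_bijective {V : Type*} {T : ColouredPregraph V} {e : V → M.Orb}
    (he : Function.Bijective e) (hadj : ∀ i u v, T.Adj i u v → M.orbAdj i (e u) = e v) :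
    M.HasType T := by
  refine ⟨{ toEquiv := (Equiv.ofBijective e he).symm, adj_iff := fun i u v => ?_ }⟩
  obtain ⟨u, rfl⟩ := he.2 u
  obtain ⟨v, rfl⟩ := he.2 v
  have hsymm : ∀ w, (Equiv.ofBijective e he).symm (e w) = w :=
    (Equiv.ofBijective e he).symm_apply_apply
  change _ ↔ T.Adj i ((Equiv.ofBijective e he).symm (e u)) ((Equiv.ofBijective e he).symm (e v))
  rw [hsymm, hsymm, symmetryTypeGraph_adj_iff]
  refine ⟨fun h => ?_, hadj i u v⟩
  obtain ⟨w, hw, -⟩ := T.existsUnique_adj i u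
  rwa [← he.1 ((hadj i u w hw).symm.trans h)]

end Orbits

/-! ### The layers of the truncation -/

section Layers

/-- The action of the flag adjacencies of a truncation on the three layers. -/
def layerPerm : Fin 3 → Equiv.Perm (Fin 3) := ![1, Equiv.swap 1 2, Equiv.swap 0 2]

theorem layerPerm_layerPerm : ∀ i j, layerPerm i (layerPerm i j) = j := by decide

variable {F : Type*} (M : FlagMap F)

theorem truncation_s_zero_zero (Φ : F) : M.truncation.s 0 (Φ, 0) = (M.s 1 Φ, 0) := rfl
theorem truncation_s_one_zero (Φ : F) : M.truncation.s 1 (Φ, 0) = (M.s 2 Φ, 0) := rfl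
theorem truncation_s_two_zero (Φ : F) : M.truncation.s 2 (Φ, 0) = (Φ, 2) := rfl
theorem truncation_s_zero_one (Φ : F) : M.truncation.s 0 (Φ, 1) = (M.s 0 Φ, 1) := rfl
theorem truncation_s_one_two (Φ : F) : M.truncation.s 1 (Φ, 2) = (Φ, 1) := rfl

theorem truncation_s_snd (i : Fin 3) (x : F × Fin 3) :
    (M.truncation.s i x).2 = layerPerm i x.2 := by
  obtain ⟨Φ, j⟩ := x
  fin_cases i <;> fin_cases j <;> rfl

/-- The underlying graph of a truncation is cubic: three faces meet at each vertex. -/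
theorem truncation_braid (u : M.truncation.Orb) :
    M.truncation.orbAdj 1 (M.truncation.orbAdj 2 (M.truncation.orbAdj 1 u)) =
      M.truncation.orbAdj 2 (M.truncation.orbAdj 1 (M.truncation.orbAdj 2 u)) := by
  obtain ⟨⟨Φ, j⟩, rfl⟩ := M.truncation.orb_surjective u
  fin_cases j <;> rfl

theorem snd_eq_of_mem_autGroup {α : Equiv.Perm (F × Fin 3)} (hα : α ∈ M.truncation.autGroup)
    {x : F × Fin 3} (hx : (α x).2 = x.2) (y : F × Fin 3) : (α y).2 = y.2 := by
  refine M.truncation.flag_induction (P := fun y => (α y).2 = y.2) (fun i y hy => ?_) hx y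
  rw [hα i y, truncation_s_snd, truncation_s_snd, hy]

theorem apply_eq_of_mem_autGroup {α : Equiv.Perm (F × Fin 3)} (hα : α ∈ M.truncation.autGroup)
    {x : F × Fin 3} (hx : (α x).2 = x.2) (Φ : F) (j : Fin 3) : α (Φ, j) = ((α (Φ, 0)).1, j) := by
  have h0 : α (Φ, 0) = ((α (Φ, 0)).1, 0) :=
    Prod.ext rfl (M.snd_eq_of_mem_autGroup hα hx (Φ, 0))
  have h2 : α (Φ, 2) = ((α (Φ, 0)).1, 2) := by
    rw [← truncation_s_two_zero, hα, h0, truncation_s_two_zero]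
  have h1 : α (Φ, 1) = ((α (Φ, 0)).1, 1) := by
    rw [← truncation_s_one_two, hα, h2, truncation_s_one_two]
  fin_cases j
  · exact h0
  · exact h1
  · exact h2

/-- An automorphism of the truncation that preserves the layer of one flag is induced by an
automorphism of the map. -/
theorem exists_mem_autGroup_of_layer_eq {α : Equiv.Perm (F × Fin 3)}
    (hα : α ∈ M.truncation.autGroup) {x : F × Fin 3} (hx : (α x).2 = x.2) :
    ∃ γ ∈ M.autGroup, ∀ Φ j, α (Φ, j) = (γ Φ, j) := by
  have hα' : α⁻¹ ∈ M.truncation.autGroup := inv_mem hα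
  have hx' : (α⁻¹ (α x)).2 = (α x).2 := by simp [hx]
  have happ := M.apply_eq_of_mem_autGroup hα hx
  have happ' := M.apply_eq_of_mem_autGroup hα' hx'
  refine ⟨⟨fun Φ => (α (Φ, 0)).1, fun Φ => (α⁻¹ (Φ, 0)).1, fun Φ => ?_, fun Φ => ?_⟩, ?_, happ⟩
  · change (α⁻¹ ((α (Φ, 0)).1, 0)).1 = Φ
    rw [← happ]
    simp
  · change (α ((α⁻¹ (Φ, 0)).1, 0)).1 = Φ
    rw [← happ']
    simp
  · intro i Φ
    change (α (M.s i Φ, 0)).1 = M.s i (α (Φ, 0)).1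
    fin_cases i
    · have h := hα 0 (Φ, 1)
      rw [truncation_s_zero_one, happ, happ Φ 1, truncation_s_zero_one] at h
      exact (Prod.ext_iff.1 h).1
    · have h := hα 0 (Φ, 0)
      rw [truncation_s_zero_zero, happ Φ 0, truncation_s_zero_zero] at h
      exact (Prod.ext_iff.1 h).1
    · have h := hα 1 (Φ, 0)
      rw [truncation_s_one_zero, happ Φ 0, truncation_s_one_zero] at h
      exact (Prod.ext_iff.1 h).1

theorem orb_truncation_eq {Φ Ψ : F} (j : Fin 3) (h : M.orb Φ = M.orb Ψ) :
    M.truncation.orb (Φ, j) = M.truncation.orb (Ψ, j) := by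
  obtain ⟨γ, hγ, rfl⟩ := M.orb_eq_iff.1 h
  refine M.truncation.orb_eq_iff.2 ⟨γ.prodCongr (Equiv.refl _), ?_, rfl⟩
  rintro i ⟨Φ, k⟩
  have hγ' : ∀ i Φ, γ (M.s i Φ) = M.s i (γ Φ) := hγ
  change Prod.map γ id (M.truncAdj i (Φ, k)) = M.truncAdj i (γ Φ, k)
  fin_cases i <;> fin_cases k <;> simp [truncAdj, hγ']

/-- The orbit of the truncation that contains the `j`-th layer of an orbit of the map. -/
def layerMap (j : Fin 3) : M.Orb → M.truncation.Orb :=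
  Quotient.lift (fun Φ => M.truncation.orb (Φ, j)) fun _ _ h =>
    M.orb_truncation_eq j (Quotient.sound h)

@[simp] theorem layerMap_orb (j : Fin 3) (Φ : F) :
    M.layerMap j (M.orb Φ) = M.truncation.orb (Φ, j) := rfl

theorem layerMap_injective (j : Fin 3) : Function.Injective (M.layerMap j) := by
  intro u v h
  obtain ⟨Φ, rfl⟩ := M.orb_surjective u
  obtain ⟨Ψ, rfl⟩ := M.orb_surjective v
  obtain ⟨α, hα, hαΨ⟩ := M.truncation.orb_eq_iff.1 h
  obtain ⟨γ, hγ, hαγ⟩ := M.exists_mem_autGroup_of_layer_eq hα (x := (Ψ, j)) (by rw [hαΨ])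
  rw [hαγ] at hαΨ
  exact M.orb_eq_iff.2 ⟨γ, hγ, (Prod.ext_iff.1 hαΨ).1⟩

theorem mem_range_layerMap_orbAdj {i j : Fin 3} {x : M.truncation.Orb} :
    M.truncation.orbAdj i x ∈ Set.range (M.layerMap (layerPerm i j)) ↔
      x ∈ Set.range (M.layerMap j) := by
  have key : ∀ j x, x ∈ Set.range (M.layerMap j) →
      M.truncation.orbAdj i x ∈ Set.range (M.layerMap (layerPerm i j)) := by
    rintro j _ ⟨u, rfl⟩
    obtain ⟨Φ, rfl⟩ := M.orb_surjective u
    refine ⟨M.orb (M.truncation.s i (Φ, j)).1, ?_⟩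
    rw [layerMap_orb, layerMap_orb, orbAdj_orb,
      show layerPerm i j = _ from (M.truncation_s_snd i (Φ, j)).symm]
  refine ⟨fun h => ?_, key j x⟩
  simpa [layerPerm_layerPerm] using key _ _ h

open Classical in
/-- All orbits of the truncation meet the same number of layers. -/
theorem card_layers_eq (x y : M.truncation.Orb) :
    (Finset.univ.filter fun j => x ∈ Set.range (M.layerMap j)).card =
      (Finset.univ.filter fun j => y ∈ Set.range (M.layerMap j)).card := by
  refine M.truncation.orb_induction (u := x)
    (P := fun y => (Finset.univ.filter fun j => x ∈ Set.range (M.layerMap j)).card =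
      (Finset.univ.filter fun j => y ∈ Set.range (M.layerMap j)).card) (fun i y h => ?_) rfl y
  rw [h]
  refine Finset.card_equiv (layerPerm i) fun j => ?_
  rw [Finset.mem_filter_univ, Finset.mem_filter_univ, mem_range_layerMap_orbAdj]

open Classical in
/-- When the truncation has `3 / 2` times as many orbits as the map, every orbit of the truncation
misses exactly one layer. -/
theorem exists_missedLayer (hM : M.IsOrbitMap 6) (hTr : M.truncation.IsOrbitMap 9) :
    ∃ L : M.truncation.Orb → Fin 3, ∀ x j, x ∈ Set.range (M.layerMap j) ↔ j ≠ L x := by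
  obtain ⟨_, hM⟩ := hM
  obtain ⟨_, hTr⟩ := hTr
  have := Fintype.ofFinite M.Orb
  have := Fintype.ofFinite M.truncation.Orb
  rw [Nat.card_eq_fintype_card] at hM hTr
  -- Count the pairs of an orbit of the truncation and a layer that it meets.
  have hcount := Finset.sum_card_bipartiteAbove_eq_sum_card_bipartiteBelow
    (s := (Finset.univ : Finset M.truncation.Orb)) (t := (Finset.univ : Finset (Fin 3)))
    fun x j => x ∈ Set.range (M.layerMap j)
  have hlayer : ∀ j : Fin 3, (Finset.bipartiteBelow (fun x j => x ∈ Set.range (M.layerMap j))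
      (Finset.univ : Finset M.truncation.Orb) j).card = 6 := by
    intro j
    rw [← hM, ← Finset.card_univ, ← Finset.card_image_of_injective _ (M.layerMap_injective j)]
    congr 1
    ext x
    simp [Finset.bipartiteBelow]
  have htwo : ∀ x, (Finset.univ.filter fun j => x ∈ Set.range (M.layerMap j)).card = 2 := by
    intro x
    rw [Finset.sum_congr rfl fun j _ => hlayer j] at hcount
    simp only [Finset.bipartiteAbove] at hcount
    have hconst : ∑ y : M.truncation.Orb, (Finset.univ.filter
          fun j => y ∈ Set.range (M.layerMap j)).card =
        ∑ _y : M.truncation.Orb, (Finset.univ.filter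
          fun j => x ∈ Set.range (M.layerMap j)).card :=
      -- The two sides may carry different decidability instances.
      Finset.sum_congr rfl fun y _ => by convert M.card_layers_eq y x
    rw [hconst] at hcount
    simp only [Finset.sum_const, Finset.card_univ, hTr, Fintype.card_fin, smul_eq_mul] at hcount
    omega
  have hone : ∀ x, ∃ l, ∀ j, x ∈ Set.range (M.layerMap j) ↔ j ≠ l := by
    intro x
    have hcompl : (Finset.univ.filter fun j => x ∈ Set.range (M.layerMap j))ᶜ.card = 1 := by
      rw [Finset.card_compl, htwo, Fintype.card_fin]
    obtain ⟨l, hl⟩ := Finset.card_eq_one.1 hcompl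
    refine ⟨l, fun j => ?_⟩
    have hj := Finset.ext_iff.1 hl j
    rw [Finset.mem_compl, Finset.mem_filter_univ, Finset.mem_singleton] at hj
    exact ⟨fun h h' => hj.2 h' h, fun h => not_not.1 fun h' => h (hj.1 h')⟩
  choose L hL using hone
  exact ⟨L, hL⟩

theorem missedLayer_orbAdj {L : M.truncation.Orb → Fin 3}
    (hL : ∀ x j, x ∈ Set.range (M.layerMap j) ↔ j ≠ L x) (i : Fin 3) (x : M.truncation.Orb) :
    L (M.truncation.orbAdj i x) = layerPerm i (L x) := by
  have h1 := hL (M.truncation.orbAdj i x) (layerPerm i (L x))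
  rw [mem_range_layerMap_orbAdj, hL] at h1
  by_contra h
  exact h1.2 (fun h' => h h'.symm) rfl

/-- The adjacencies of the symmetry type graph of the map, read off in layer `0` of the
truncation. -/
theorem layerMap_zero_orbAdj (u : M.Orb) :
    M.layerMap 0 (M.orbAdj 0 u) = M.truncation.orbAdj 2 (M.truncation.orbAdj 1
        (M.truncation.orbAdj 0 (M.truncation.orbAdj 1 (M.truncation.orbAdj 2 (M.layerMap 0 u))))) ∧
      M.layerMap 0 (M.orbAdj 1 u) = M.truncation.orbAdj 0 (M.layerMap 0 u) ∧
      M.layerMap 0 (M.orbAdj 2 u) = M.truncation.orbAdj 1 (M.layerMap 0 u) := by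
  obtain ⟨Φ, rfl⟩ := M.orb_surjective u
  exact ⟨rfl, rfl, rfl⟩

end Layers

/-! ### Graphs with three layers are truncations -/

section TruncatedGraphs

/-- The truncation of the coloured pregraph on `V` whose edge of colour `i` at `v` joins `v` to
`s i v`. -/
def truncStep {V : Type*} (s : Fin 3 → V → V) : Fin 3 → V × Fin 3 → V × Fin 3
  | 0, (v, 0) => (s 1 v, 0)
  | 1, (v, 0) => (s 2 v, 0)
  | 2, (v, 0) => (v, 2)
  | 0, (v, 1) => (s 0 v, 1)
  | 1, (v, 1) => (v, 2)
  | 2, (v, 1) => (s 2 v, 1)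
  | 0, (v, 2) => (s 1 v, 2)
  | 1, (v, 2) => (v, 1)
  | 2, (v, 2) => (v, 0)

/-- The graph `3^0`. -/
def type30 : Fin 3 → Fin 3 → Fin 3 := ![![0, 1, 2], ![0, 2, 1], ![1, 0, 2]]

/-- The graph `3^2`. -/
def type32 : Fin 3 → Fin 3 → Fin 3 := ![![1, 0, 2], ![0, 2, 1], ![0, 1, 2]]

/-- The graph `3^{02}`. -/
def type302 : Fin 3 → Fin 3 → Fin 3 := ![![1, 0, 2], ![0, 2, 1], ![1, 0, 2]]

/-- On three points, involutions without a common fixed point generate a transitive group, as an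
invariant subset of one or two points would give a common fixed point. If moreover those of colours
`0` and `2` commute, then these are equal or one of them is trivial, and the one of colour `1` is a
different transposition. -/
theorem three_vertex_classification : ∀ a : Fin 3 → Fin 3, (∀ x, a (a x) = x) →
    ∀ c : Fin 3 → Fin 3, (∀ x, c (c x) = x) → (∀ x, a (c x) = c (a x)) →
    ∀ b : Fin 3 → Fin 3, (∀ x, b (b x) = x) → (∀ x, ¬ (a x = x ∧ b x = x ∧ c x = x)) →
    (∃ σ : Equiv.Perm (Fin 3), ∀ i x, (![a, b, c] : Fin 3 → Fin 3 → Fin 3) i (σ x)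
      = σ (type30 i x)) ∨
    (∃ σ : Equiv.Perm (Fin 3), ∀ i x, (![a, b, c] : Fin 3 → Fin 3 → Fin 3) i (σ x)
      = σ (type32 i x)) ∨
    (∃ σ : Equiv.Perm (Fin 3), ∀ i x, (![a, b, c] : Fin 3 → Fin 3 → Fin 3) i (σ x)
      = σ (type302 i x)) := by
  set_option maxRecDepth 10000 in decide

/-- A connected graph with nine vertices whose vertices are labelled by layers that the adjacencies
permute as in a truncation is the truncation of the three-vertex graph on its layer `0`. -/
theorem exists_truncStep_model {X : Type*} {p : Fin 3 → X → X} {L : X → Fin 3}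
    (hinv : ∀ i x, p i (p i x) = x) (hcomm : ∀ x, p 0 (p 2 x) = p 2 (p 0 x))
    (hbraid : ∀ x, p 1 (p 2 (p 1 x)) = p 2 (p 1 (p 2 x)))
    (hconn : ∀ P : X → Prop, (∀ i x, P x → P (p i x)) → ∀ x, P x → ∀ y, P y)
    (hL : ∀ i x, L (p i x) = layerPerm i (L x)) (hcard : Nat.card X = 9) :
    ∃ s, (s = type30 ∨ s = type32 ∨ s = type302) ∧
      ∃ e : Fin 3 × Fin 3 → X, Function.Bijective e ∧ (∀ x, L (e x) = x.2) ∧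
        ∀ i x, p i (e x) = e (truncStep s i x) := by
  have hL1 : ∀ x, L x = 0 → L (p 1 (p 2 x)) = 1 := fun x h => by rw [hL, hL, h]; rfl
  have hL2 : ∀ x, L x = 0 → L (p 2 x) = 2 := fun x h => by rw [hL, h]; rfl
  -- `V` is layer `0`, and `(v, j)` stands for the vertex of layer `j` that belongs to `v`.
  let V := {x // L x = 0}
  let emb : V × Fin 3 → X := fun y => ![y.1.1, p 1 (p 2 y.1.1), p 2 y.1.1] y.2
  have hLemb : ∀ y, L (emb y) = y.2 := by
    rintro ⟨⟨x, hx⟩, j⟩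
    fin_cases j
    · exact hx
    · exact hL1 x hx
    · exact hL2 x hx
  have hemb : Function.Bijective emb := by
    constructor
    · rintro ⟨⟨x, hx⟩, j⟩ ⟨⟨y, hy⟩, k⟩ h
      have hjk : j = k := by simpa [hLemb] using congrArg L h
      subst hjk
      have hxy : x = y := by
        fin_cases j
        · exact h
        · have h' : p 1 (p 2 x) = p 1 (p 2 y) := h
          simpa [hinv] using congrArg (fun z => p 2 (p 1 z)) h'
        · have h' : p 2 x = p 2 y := h
          simpa [hinv] using congrArg (p 2) h'
      subst hxy
      rfl
    · intro x
      rcases (by decide : ∀ j : Fin 3, j = 0 ∨ j = 1 ∨ j = 2) (L x) with h | h | h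
      · exact ⟨(⟨x, h⟩, 0), rfl⟩
      · refine ⟨(⟨p 2 (p 1 x), by rw [hL, hL, h]; rfl⟩, 1), ?_⟩
        change p 1 (p 2 (p 2 (p 1 x))) = x
        rw [hinv, hinv]
      · refine ⟨(⟨p 2 x, by rw [hL, h]; rfl⟩, 2), ?_⟩
        change p 2 (p 2 x) = x
        rw [hinv]
  -- Colours `1` and `2` are read off in layer `0`; colour `0` is that of layer `1`, carried back to
  -- layer `0`.
  let s : Fin 3 → V → V := ![
    fun v => ⟨p 2 (p 1 (p 0 (p 1 (p 2 v.1)))), by simp only [hL, v.2]; rfl⟩,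
    fun v => ⟨p 0 v.1, by rw [hL, v.2]; rfl⟩,
    fun v => ⟨p 1 v.1, by rw [hL, v.2]; rfl⟩]
  have hstep : ∀ i y, p i (emb y) = emb (truncStep s i y) := by
    rintro i ⟨⟨x, hx⟩, j⟩
    fin_cases i <;> fin_cases j
    · rfl
    · change p 0 (p 1 (p 2 x)) = p 1 (p 2 (p 2 (p 1 (p 0 (p 1 (p 2 x))))))
      rw [hinv, hinv]
    · exact hcomm x
    · rfl
    · exact hinv 1 _
    · rfl
    · rfl
    · exact (hbraid x).symm
    · exact hinv 2 x
  have hcardV : Nat.card V = 3 := by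
    have h := Nat.card_congr (Equiv.ofBijective emb hemb)
    rw [Nat.card_prod, Nat.card_fin, hcard] at h
    omega
  have : Finite V := Nat.finite_of_card_ne_zero (by omega)
  let τ : V ≃ Fin 3 := Finite.equivFinOfCardEq hcardV
  let t : Fin 3 → Fin 3 → Fin 3 := fun i x => τ (s i (τ.symm x))
  have ht : ∀ i, t i ∘ τ = τ ∘ s i := fun i => funext fun v => by simp [t]
  have hs0 : ∀ v, s 0 (s 0 v) = v := fun v => Subtype.ext <| by
    change p 2 (p 1 (p 0 (p 1 (p 2 (p 2 (p 1 (p 0 (p 1 (p 2 v.1))))))))) = v.1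
    simp only [hinv]
  have hs1 : ∀ v, s 1 (s 1 v) = v := fun v => Subtype.ext (hinv 0 v.1)
  have hs2 : ∀ v, s 2 (s 2 v) = v := fun v => Subtype.ext (hinv 1 v.1)
  have hs02 : ∀ v, s 0 (s 2 v) = s 2 (s 0 v) := fun v => Subtype.ext <| by
    change p 2 (p 1 (p 0 (p 1 (p 2 (p 1 v.1))))) = p 1 (p 2 (p 1 (p 0 (p 1 (p 2 v.1)))))
    rw [hbraid v.1, hcomm, hbraid (p 0 _)]
  -- A common fixed point would be the layer `0` of a connected component with three vertices.
  have hfix : ∀ v, ¬ (s 0 v = v ∧ s 1 v = v ∧ s 2 v = v) := by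
    rintro v ⟨h0, h1, h2⟩
    have hall : ∀ w : V, w = v := by
      intro w
      obtain ⟨j, hj⟩ := hconn (fun x => ∃ j, emb (v, j) = x)
        (by
          rintro i _ ⟨j, rfl⟩
          rw [hstep]
          fin_cases i <;> fin_cases j <;> simp only [truncStep, h0, h1, h2] <;>
            exact ⟨_, rfl⟩) (emb (v, 0)) ⟨0, rfl⟩ (emb (w, 0))
      exact (Prod.ext_iff.1 (hemb.1 hj)).1.symm
    have : Subsingleton V := ⟨fun a b => (hall a).trans (hall b).symm⟩
    have := Finite.card_le_one_iff_subsingleton.2 this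
    omega
  have hclass := three_vertex_classification (t 0) (fun x => by simp [t, hs0]) (t 2)
    (fun x => by simp [t, hs2]) (fun x => by simp [t, hs02]) (t 1) (fun x => by simp [t, hs1])
    (fun x hx => hfix (τ.symm x) ⟨by simpa [t, Equiv.eq_symm_apply] using hx.1,
      by simpa [t, Equiv.eq_symm_apply] using hx.2.1,
      by simpa [t, Equiv.eq_symm_apply] using hx.2.2⟩)
  -- Relabel the three vertices.
  have hmodel : ∀ T : Fin 3 → Fin 3 → Fin 3, (∃ σ : Equiv.Perm (Fin 3), ∀ i x,
      (![t 0, t 1, t 2] : Fin 3 → Fin 3 → Fin 3) i (σ x) = σ (T i x)) →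
      ∃ e : Fin 3 × Fin 3 → X, Function.Bijective e ∧ (∀ x, L (e x) = x.2) ∧
        ∀ i x, p i (e x) = e (truncStep T i x) := by
    rintro T ⟨σ, hσ⟩
    have hsT : ∀ i x, s i (τ.symm (σ x)) = τ.symm (σ (T i x)) := by
      intro i x
      rw [Equiv.eq_symm_apply, ← hσ]
      fin_cases i <;> rfl
    refine ⟨fun y => emb (τ.symm (σ y.1), y.2),
      hemb.comp ((σ.trans τ.symm).prodCongr (Equiv.refl _)).bijective, fun y => hLemb _, ?_⟩
    rintro i ⟨x, j⟩
    dsimp only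
    rw [hstep]
    fin_cases i <;> fin_cases j <;> simp only [truncStep, hsT]
  rcases hclass with h | h | h
  · exact ⟨_, Or.inl rfl, hmodel _ h⟩
  · exact ⟨_, Or.inr (Or.inl rfl), hmodel _ h⟩
  · exact ⟨_, Or.inr (Or.inr rfl), hmodel _ h⟩

end TruncatedGraphs

/-! ### Recognising the types -/

section Types

open ColouredPregraph

theorem type9A_adj : ∀ i u v, type9A.Adj i u v →
    truncStep type30 i (finProdFinEquiv.symm u) = finProdFinEquiv.symm v := by
  unfold type9A ofInvolutions
  decide

theorem type9B_adj : ∀ i u v, type9B.Adj i u v →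
    truncStep type32 i (finProdFinEquiv.symm u) = finProdFinEquiv.symm v := by
  unfold type9B ofInvolutions
  decide

theorem type9Cd_adj : ∀ i u v, type9Cd.Adj i u v →
    truncStep type302 i (finProdFinEquiv.symm u) = finProdFinEquiv.symm v := by
  unfold type9Cd ofInvolutions
  decide

/-- The words in the adjacencies of a truncation that induce the adjacencies of the original graph
on layer `0`. -/
def layerZeroStep {V : Type*} (s : Fin 3 → V → V) (x : V × Fin 3) : Fin 3 → V × Fin 3 :=
  ![truncStep s 2 (truncStep s 1 (truncStep s 0 (truncStep s 1 (truncStep s 2 x)))),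
    truncStep s 0 x, truncStep s 1 x]

/-- The vertices of `6_D` as vertices outside layer `0` of the truncation of `3^0`. -/
def embed6D : Fin 6 → Fin 3 × Fin 3 := ![(1, 1), (1, 2), (2, 2), (0, 2), (2, 1), (0, 1)]

/-- The vertices of `6_F` as vertices outside layer `0` of the truncation of `3^2`. -/
def embed6F : Fin 6 → Fin 3 × Fin 3 := ![(0, 2), (0, 1), (1, 1), (2, 1), (1, 2), (2, 2)]

/-- The vertices of `6_{M_opp}` as vertices outside layer `0` of the truncation of `3^{02}`. -/
def embed6Mopp : Fin 6 → Fin 3 × Fin 3 := ![(1, 1), (0, 1), (1, 2), (2, 1), (0, 2), (2, 2)]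

theorem type6D_adj : ∀ i u v, type6D.Adj i u v →
    layerZeroStep type30 (embed6D u) i = embed6D v := by
  unfold type6D ofInvolutions
  decide

theorem type6F_adj : ∀ i u v, type6F.Adj i u v →
    layerZeroStep type32 (embed6F u) i = embed6F v := by
  unfold type6F ofInvolutions
  decide

theorem type6Mopp_adj : ∀ i u v, type6Mopp.Adj i u v →
    layerZeroStep type302 (embed6Mopp u) i = embed6Mopp v := by
  unfold type6Mopp ofInvolutions
  decide

variable {F : Type*} (M : FlagMap F)

/-- From a description of the symmetry type graph of the truncation as a truncated graph in which the
layer of a vertex is the layer missed by the orbit, both types can be read off. -/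
theorem hasType_of_model (hM : M.IsOrbitMap 6) {L : M.truncation.Orb → Fin 3}
    (hL : ∀ x j, x ∈ Set.range (M.layerMap j) ↔ j ≠ L x) {s : Fin 3 → Fin 3 → Fin 3}
    {e : Fin 3 × Fin 3 → M.truncation.Orb} (he : Function.Bijective e) (hLe : ∀ x, L (e x) = x.2)
    (hadj : ∀ i x, M.truncation.orbAdj i (e x) = e (truncStep s i x))
    {T : ColouredPregraph (Fin 6)} {g : Fin 6 → Fin 3 × Fin 3} (hg : Function.Injective g)
    (hg0 : ∀ w, (0 : Fin 3) ≠ (g w).2) (hT : ∀ i u v, T.Adj i u v → layerZeroStep s (g u) i = g v)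
    {N : ColouredPregraph (Fin 9)} (hN : ∀ i u v, N.Adj i u v →
      truncStep s i (finProdFinEquiv.symm u) = finProdFinEquiv.symm v) :
    M.HasType T ∧ M.truncation.HasType N := by
  constructor
  · obtain ⟨_, hcard⟩ := hM
    have hrange : ∀ w, ∃ u, M.layerMap 0 u = e (g w) := fun w =>
      (hL _ 0).2 (by rw [hLe]; exact hg0 w)
    choose f hf using hrange
    have hfinj : Function.Injective f := fun u v h =>
      hg (he.1 (by rw [← hf, ← hf, h]))
    have hfbij : Function.Bijective f :=
      (Nat.bijective_iff_injective_and_card f).2 ⟨hfinj, by rw [hcard, Nat.card_fin]⟩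
    refine M.hasType_of_bijective hfbij fun i u v huv => M.layerMap_injective 0 ?_
    obtain ⟨h0, h1, h2⟩ := M.layerMap_zero_orbAdj (f u)
    rw [hf v, ← hT i u v huv]
    simp only [hf, hadj] at h0 h1 h2
    fin_cases i
    · exact h0
    · exact h1
    · exact h2
  · refine M.truncation.hasType_of_bijective (e := fun u => e (finProdFinEquiv.symm u))
      (he.comp (finProdFinEquiv (m := 3) (n := 3)).symm.bijective) fun i u v huv => ?_
    rw [hadj, hN i u v huv]

theorem HasType.iso {M : FlagMap F} {V W : Type*} {G : ColouredPregraph V} {H : ColouredPregraph W}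
    (hG : M.HasType G) (hH : M.HasType H) :
    ∃ e : V ≃ W, ∀ i u v, G.Adj i u v ↔ H.Adj i (e u) (e v) := by
  obtain ⟨a⟩ := hG
  obtain ⟨b⟩ := hH
  refine ⟨a.toEquiv.symm.trans b.toEquiv, fun i u v => ?_⟩
  obtain ⟨u, rfl⟩ := a.toEquiv.surjective u
  obtain ⟨v, rfl⟩ := a.toEquiv.surjective v
  simpa using (a.adj_iff i u v).symm.trans (b.adj_iff i u v)

/-- Two types of one map have equally many semi-edges of each colour. -/
theorem HasType.card_semiedges_eq {M : FlagMap F} {V W : Type*} {G : ColouredPregraph V}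
    {H : ColouredPregraph W} (hG : M.HasType G) (hH : M.HasType H) (i : Fin 3) :
    Nat.card {v // G.Adj i v v} = Nat.card {v // H.Adj i v v} := by
  obtain ⟨e, he⟩ := hG.iso hH
  exact Nat.card_congr (e.subtypeEquiv fun v => he i v v)

theorem card_semiedges_type9A : Nat.card {v // type9A.Adj 0 v v} = 5 := by
  unfold type9A ofInvolutions
  rw [Nat.card_eq_fintype_card]
  decide

theorem card_semiedges_type9B : Nat.card {v // type9B.Adj 0 v v} = 3 ∧
    Nat.card {v // type9B.Adj 1 v v} = 3 := by
  unfold type9B ofInvolutions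
  rw [Nat.card_eq_fintype_card, Nat.card_eq_fintype_card]
  decide

theorem card_semiedges_type9Cd : Nat.card {v // type9Cd.Adj 0 v v} = 3 ∧
    Nat.card {v // type9Cd.Adj 1 v v} = 1 := by
  unfold type9Cd ofInvolutions
  rw [Nat.card_eq_fintype_card, Nat.card_eq_fintype_card]
  decide

end Types

end FlagMap

theorem mainTheorem6 {F : Type*} (M : FlagMap F) (hM : M.IsOrbitMap 6)
    (hTr : M.truncation.IsOrbitMap 9) :
    ((M.HasType ColouredPregraph.type6D ∧ M.truncation.HasType ColouredPregraph.type9A) ∨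
      (M.HasType ColouredPregraph.type6F ∧ M.truncation.HasType ColouredPregraph.type9B) ∨
      (M.HasType ColouredPregraph.type6Mopp ∧ M.truncation.HasType ColouredPregraph.type9Cd)) ∧
    ¬ ((M.HasType ColouredPregraph.type6D ∧ M.truncation.HasType ColouredPregraph.type9A) ∧
      (M.HasType ColouredPregraph.type6F ∧ M.truncation.HasType ColouredPregraph.type9B)) ∧
    ¬ ((M.HasType ColouredPregraph.type6D ∧ M.truncation.HasType ColouredPregraph.type9A) ∧
      (M.HasType ColouredPregraph.type6Mopp ∧ M.truncation.HasType ColouredPregraph.type9Cd)) ∧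
    ¬ ((M.HasType ColouredPregraph.type6F ∧ M.truncation.HasType ColouredPregraph.type9B) ∧
      (M.HasType ColouredPregraph.type6Mopp ∧ M.truncation.HasType ColouredPregraph.type9Cd)) := by
  refine ⟨?_, ?_, ?_, ?_⟩
  · obtain ⟨L, hL⟩ := M.exists_missedLayer hM hTr
    obtain ⟨s, hs, e, he, hLe, hadj⟩ := FlagMap.exists_truncStep_model
      M.truncation.orbAdj_orbAdj M.truncation.orbAdj_comm M.truncation_braid
      (fun P hP x hx => M.truncation.orb_induction hP hx) (M.missedLayer_orbAdj hL) hTr.2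
    rcases hs with rfl | rfl | rfl
    · exact Or.inl (M.hasType_of_model hM hL he hLe hadj (g := FlagMap.embed6D) (by decide)
        (by decide) FlagMap.type6D_adj FlagMap.type9A_adj)
    · exact Or.inr (Or.inl (M.hasType_of_model hM hL he hLe hadj (g := FlagMap.embed6F) (by decide)
        (by decide) FlagMap.type6F_adj FlagMap.type9B_adj))
    · exact Or.inr (Or.inr (M.hasType_of_model hM hL he hLe hadj (g := FlagMap.embed6Mopp)
        (by decide) (by decide) FlagMap.type6Mopp_adj FlagMap.type9Cd_adj))
  · rintro ⟨⟨-, h⟩, -, h'⟩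
    have := h.card_semiedges_eq h' 0
    rw [FlagMap.card_semiedges_type9A, FlagMap.card_semiedges_type9B.1] at this
    omega
  · rintro ⟨⟨-, h⟩, -, h'⟩
    have := h.card_semiedges_eq h' 0
    rw [FlagMap.card_semiedges_type9A, FlagMap.card_semiedges_type9Cd.1] at this
    omega
  · rintro ⟨⟨-, h⟩, -, h'⟩
    have := h.card_semiedges_eq h' 1
    rw [FlagMap.card_semiedges_type9B.2, FlagMap.card_semiedges_type9Cd.2] at this
    omega
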